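/- For a polynomial or rational function $a$ in $q$ and an integer $k\ge 0$ let $(a;q^d)_k=(1-a)(1-aq^d)\cdots(1-aq^{d(k-1)})$, let $[m]=1+q+\cdots+q^{m-1}$, and let $\Phi_n(q)$ be the $n$-th cyclotomic polynomial. For $P\in\mathbb{Q}[q]$ and a rational function $f\in\mathbb{Q}(q)$, write $f\equiv 0\pmod{P}$ if $f=A/B$ with $A,B\in\mathbb{Q}[q]$, $B\neq 0$ coprime to $P$, and $P\mid A$. **Theorem 1.1.** Let $d\ge 5$ be an odd integer and let $n$ be a positive integer. Then $$\sum_{k=0}^{n-1}[2dk+1]\frac{(q;q^d)_k^d}{(q^d;q^d)_k^d}\,q^{d(d-3)k/2}\equiv\begin{cases}0\pmod{\Phi_n(q)^2}, & \text{if } n\equiv -1\pmod d,\\ 0\pmod{\Phi_n(q)^3}, & \text{if } n\equiv -\tfrac12\pmod d,\end{cases}$$ where $n\equiv-\tfrac12\pmod d$ means $2n\equiv -1\pmod d$. -/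

import Mathlib

open Polynomial

/-- The `q`-shifted factorial `(a; q)_k = (1 - a) (1 - a q) ⋯ (1 - a q^(k-1))`. -/
def qShiftedFactorial {R : Type*} [CommRing R] (a q : R) (k : ℕ) : R :=
  ∏ i ∈ Finset.range k, (1 - a * q ^ i)

/-- The `q`-integer `[m]_q = 1 + q + ⋯ + q^(m-1)`. -/
def qInteger {R : Type*} [CommRing R] (q : R) (m : ℕ) : R :=
  ∑ i ∈ Finset.range m, q ^ i

/-- Congruence `f ≡ g (mod P)` of rational functions in one variable over `ℚ` modulo a
polynomial `P`: the difference `f - g` is a quotient of polynomials whose denominator is coprime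
to `P` and whose numerator is divisible by `P`. -/
def RatFuncModEq (P : ℚ[X]) (f g : RatFunc ℚ) : Prop :=
  ∃ a b : ℚ[X], b ≠ 0 ∧ IsCoprime b P ∧ P ∣ a ∧
    f - g = algebraMap ℚ[X] (RatFunc ℚ) a / algebraMap ℚ[X] (RatFunc ℚ) b

/-- The truncated series
`∑_{k=0}^{n-1} [2dk+1] (q;q^d)_k^d / (q^d;q^d)_k^d * q^(d(d-3)k/2)`
as a rational function of the indeterminate `q` over `ℚ`.  It is used for odd `d ≥ 5` only, where
the subtraction and the division by `2` in the exponent are exact. -/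
noncomputable def truncatedSeries (d n : ℕ) : RatFunc ℚ :=
  let q : RatFunc ℚ := RatFunc.X
  ∑ k ∈ Finset.range n,
    qInteger q (2 * d * k + 1) *
      (qShiftedFactorial q (q ^ d) k ^ d / qShiftedFactorial (q ^ d) (q ^ d) k ^ d) *
      q ^ (d * (d - 3) * k / 2)

/-! ### Terminating very-well-poised sums as divided differences -/

section WellPoised

variable {K : Type*} [Field K]

/-! Put `Q = q^d`, `a = q`, `d = 2h + 3`. Up to the factor `1 - q`, the series is very-well-poised
in base `Q` with all `d` parameters equal to `a`. Deform them to `a x^c` with `x = q^n` and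
exponents `0`, `s - d`, `e` and `h` copies of a pair `(α, β)` with `α + β = s`. Here `s` is 1 or 2
with `s n ≡ -1 (mod d)`, and `e` makes the total exponent 0.

Now `a x^(s-d) = Q^(-M)` terminates the sum at `M`. The factors for `e` and for the pairs together
are `Q^(mk) P(y_k)` with `deg P ≤ m = M - h` on the lattice `y_k = Q^(-k) + a Q^k`. What remains is
the Lagrange weight of the nodes, so the sum is a multiple of the coefficient of degree `M` of `P`,
which is 0 (`wellPoised_weight`, `sum_wellPoised_eq_zero`).

Expand in `t = q^n - 1`. Because the exponents add up to 0, each deformed term is the original one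
times `1 + D_k π t^2 + O(t^3)`, where `π` is the sum of the squared exponents and `D_k` does not
depend on them. Two pairs with different `π` allow the `t^2` term to be eliminated, so the original
sum up to `M` vanishes modulo `t^3` (`exists_sum_eq_cube_mul`). The terms with `M < k < n` contain
`t^d`. All this happens over the fractions with denominator prime to `Φ_n`, and it gives a cube in
both residue classes. -/

theorem qShiftedFactorial_add {R : Type*} [CommRing R] (a q : R) (k m : ℕ) :
    qShiftedFactorial a q (k + m) = qShiftedFactorial a q k * qShiftedFactorial (a * q ^ k) q m := by
  simp only [qShiftedFactorial, Finset.prod_range_add, pow_add, mul_assoc]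

/-- The numerator of the ratio `(b; q)_k / (a q / b; q)_k` over the common denominator
`(a q / b; q)_M`. -/
def wellPoisedFactor (a q : K) (M : ℕ) (b : K) (k : ℕ) : K :=
  qShiftedFactorial b q k * qShiftedFactorial (a * q / b * q ^ k) q (M - k)

/-- The Askey–Wilson type lattice `q^(-k) + a q^k`. -/
def quadraticNode (a q : K) (k : ℕ) : K := (q ^ k)⁻¹ + a * q ^ k

/-- `f k = q^(m k) P(q^(-k) + a q^k)` for all `k ≤ M`, with `P` of degree at most `m`. -/
def IsNodePolynomial (a q : K) (M m : ℕ) (f : ℕ → K) : Prop :=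
  ∃ P : K[X], P.natDegree ≤ m ∧
    ∀ k ≤ M, f k = q ^ (m * k) * P.eval (quadraticNode a q k)

variable {a q : K} {M : ℕ}

theorem IsNodePolynomial.mul {m m' : ℕ} {f f' : ℕ → K} (hf : IsNodePolynomial a q M m f)
    (hf' : IsNodePolynomial a q M m' f') :
    IsNodePolynomial a q M (m + m') (fun k => f k * f' k) := by
  obtain ⟨P, hP, h⟩ := hf
  obtain ⟨P', hP', h'⟩ := hf'
  refine ⟨P * P', natDegree_mul_le.trans (add_le_add hP hP'), fun k hk => ?_⟩
  beta_reduce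
  rw [h k hk, h' k hk, eval_mul]
  ring

theorem IsNodePolynomial.pow {m : ℕ} {f : ℕ → K} (hf : IsNodePolynomial a q M m f) (h : ℕ) :
    IsNodePolynomial a q M (h * m) (fun k => f k ^ h) := by
  obtain ⟨P, hP, hf⟩ := hf
  refine ⟨P ^ h, natDegree_pow_le_of_le h hP, fun k hk => ?_⟩
  beta_reduce
  rw [hf k hk, eval_pow]
  ring

theorem IsNodePolynomial.of_const_mul {m : ℕ} {f f' : ℕ → K} {c : K} (hc : c ≠ 0) (c' : K)
    (hf' : IsNodePolynomial a q M m f') (h : ∀ k ≤ M, c * f k = c' * f' k) :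
    IsNodePolynomial a q M m f := by
  obtain ⟨P, hP, hf'⟩ := hf'
  refine ⟨C (c' / c) * P, natDegree_C_mul_le _ _ |>.trans hP, fun k hk => ?_⟩
  have := h k hk
  rw [hf' k hk] at this
  rw [eval_mul, eval_C]
  field_simp
  linear_combination this

/-- Reversing the second product pairs `1 - u q^k` with `1 - (a/u) q^k`, where `u = B q^j`; their
product is `q^k (y_k - u - a/u)` with `y_k` the node. -/
theorem isNodePolynomial_qShiftedFactorial_mul (hq : q ≠ 0) (ha : a ≠ 0) {B B' : K} {m : ℕ}
    (hB : B * B' * q ^ m = a * q) :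
    IsNodePolynomial a q M m
      (fun k => qShiftedFactorial (B * q ^ k) q m * qShiftedFactorial (B' * q ^ k) q m) := by
  have hB0 : B ≠ 0 := by
    rintro rfl
    simp [ha, hq] at hB
  refine ⟨∏ j ∈ Finset.range m, (X - C (B * q ^ j + a / (B * q ^ j))), ?_, fun k _ => ?_⟩
  · refine (natDegree_prod_le _ _).trans ?_
    simp only [natDegree_X_sub_C, Finset.sum_const, Finset.card_range, smul_eq_mul, mul_one, le_refl]
  · have hrev : qShiftedFactorial (B' * q ^ k) q m =
        ∏ j ∈ Finset.range m, (1 - a / (B * q ^ j) * q ^ k) := by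
      rw [qShiftedFactorial, ← Finset.prod_range_reflect]
      refine Finset.prod_congr rfl fun j hj => ?_
      have hj := Finset.mem_range.1 hj
      have : q ^ m = q ^ (m - 1 - j) * q ^ j * q := by
        rw [← pow_add, ← pow_succ]; congr 1; omega
      rw [this] at hB
      field_simp
      have h2 : B * B' * (q ^ (m - 1 - j) * q ^ j) = a := by
        apply mul_right_cancel₀ hq
        linear_combination hB
      linear_combination -q ^ k * h2
    have hpow : q ^ (m * k) = ∏ _j ∈ Finset.range m, q ^ k := by
      rw [Finset.prod_const, Finset.card_range, ← pow_mul, mul_comm]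
    beta_reduce
    rw [hrev, qShiftedFactorial, ← Finset.prod_mul_distrib, eval_prod, hpow,
      ← Finset.prod_mul_distrib]
    refine Finset.prod_congr rfl fun j _ => ?_
    simp only [quadraticNode, eval_sub, eval_X, eval_C]
    field_simp
    ring

/-- Cleared form of `(B q^m)_k / (B)_k = (B q^k)_m / (B)_m`: a ratio of length `k` collapses to one
of length `m`, fixed as `k` varies. -/
theorem qShiftedFactorial_mul_wellPoised (B : K) (m k : ℕ) (hk : k ≤ M) :
    qShiftedFactorial B q m *
        (qShiftedFactorial (B * q ^ m) q k * qShiftedFactorial (B * q ^ k) q (M - k)) =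
      qShiftedFactorial B q M * qShiftedFactorial (B * q ^ k) q m := by
  have h1 := qShiftedFactorial_add B q m k
  have h2 := qShiftedFactorial_add B q k m
  have h3 := qShiftedFactorial_add B q k (M - k)
  rw [Nat.add_sub_cancel' hk] at h3
  rw [add_comm m k] at h1
  rw [h3]
  linear_combination (h2 - h1) * qShiftedFactorial (B * q ^ k) q (M - k)

/-- As `b' = (a q / b) q^m` and `b = (a q / b') q^m`, the numerator of each parameter cancels
against the denominator of the other, leaving two products of length `m`. -/
theorem isNodePolynomial_wellPoisedFactor_mul (hq : q ≠ 0) (ha : a ≠ 0) {b b' : K} {m : ℕ}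
    (hb : b ≠ 0) (hb' : b' ≠ 0) (hbb : b * b' = a * q ^ (m + 1))
    (h : qShiftedFactorial (a * q / b) q m ≠ 0) (h' : qShiftedFactorial (a * q / b') q m ≠ 0) :
    IsNodePolynomial a q M m
      (fun k => wellPoisedFactor a q M b k * wellPoisedFactor a q M b' k) := by
  have e1 : b' = a * q / b * q ^ m := by field_simp; linear_combination hbb
  have e2 : b = a * q / b' * q ^ m := by field_simp; linear_combination hbb
  have hBB : (a * q / b) * (a * q / b') * q ^ m = a * q := by
    field_simp; linear_combination -hbb
  refine (isNodePolynomial_qShiftedFactorial_mul hq ha hBB).of_const_mul (mul_ne_zero h h')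
    (qShiftedFactorial (a * q / b) q M * qShiftedFactorial (a * q / b') q M) fun k hk => ?_
  have h1 := qShiftedFactorial_mul_wellPoised (q := q) (a * q / b) m k hk
  have h2 := qShiftedFactorial_mul_wellPoised (q := q) (a * q / b') m k hk
  rw [← e1] at h1
  rw [← e2] at h2
  calc _ = (qShiftedFactorial (a * q / b) q m *
        (qShiftedFactorial b' q k * qShiftedFactorial (a * q / b * q ^ k) q (M - k))) *
        (qShiftedFactorial (a * q / b') q m *
        (qShiftedFactorial b q k * qShiftedFactorial (a * q / b' * q ^ k) q (M - k))) := by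
        simp only [wellPoisedFactor]; ring
    _ = _ := by rw [h1, h2]; ring

/-- The self-paired case: `b = (a q / b) q^(2m)` leaves `2m` factors, whose two halves serve as the
pair of products. -/
theorem isNodePolynomial_wellPoisedFactor (hq : q ≠ 0) (ha : a ≠ 0) {b : K} {m : ℕ}
    (hb : b ≠ 0) (hbb : b ^ 2 = a * q ^ (2 * m + 1))
    (h : qShiftedFactorial (a * q / b) q (2 * m) ≠ 0) :
    IsNodePolynomial a q M m (wellPoisedFactor a q M b) := by
  have e1 : b = a * q / b * q ^ (2 * m) := by field_simp; linear_combination hbb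
  have hBB : (a * q / b) * (a * q / b * q ^ m) * q ^ m = a * q := by
    field_simp; rw [hbb]; ring
  refine (isNodePolynomial_qShiftedFactorial_mul hq ha hBB).of_const_mul h
    (qShiftedFactorial (a * q / b) q M) fun k hk => ?_
  have h1 := qShiftedFactorial_mul_wellPoised (q := q) (a * q / b) (2 * m) k hk
  rw [← e1, two_mul, qShiftedFactorial_add (a * q / b * q ^ k), mul_right_comm _ (q ^ k)] at h1
  rw [two_mul]
  exact h1

/-- Node differences factor as `(q^(-k) - q^(-j)) (1 - a q^(k+j))`. Each kind of factor completes
the shifted factorials to full products free of `k`, so the well-poised weight is a Lagrange weight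
up to a constant and a power of `q^k`. -/
theorem wellPoised_weight (hq : q ≠ 0) (ha : a ≠ 0) {k : ℕ} (hk : k ≤ M) :
    (1 - a * q ^ (2 * k)) * wellPoisedFactor a q M a k * wellPoisedFactor a q M (q ^ M)⁻¹ k *
        q ^ (M * k) *
        ∏ j ∈ (Finset.range (M + 1)).erase k, (quadraticNode a q k - quadraticNode a q j) =
      qShiftedFactorial a q (2 * M + 1) * qShiftedFactorial q q M *
        ∏ i ∈ Finset.range M, (1 - (q ^ (i + 1))⁻¹) := by
  have hmem : k ∈ Finset.range (M + 1) := Finset.mem_range.2 (by omega)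
  have h1 : ∏ j ∈ (Finset.range (M + 1)).erase k, (quadraticNode a q k - quadraticNode a q j) =
      (∏ j ∈ (Finset.range (M + 1)).erase k, ((q ^ k)⁻¹ - (q ^ j)⁻¹)) *
      ∏ j ∈ (Finset.range (M + 1)).erase k, (1 - a * q ^ k * q ^ j) := by
    rw [← Finset.prod_mul_distrib]
    refine Finset.prod_congr rfl fun j _ => ?_
    simp only [quadraticNode]
    field_simp
    ring
  have h2 : (1 - a * q ^ (2 * k)) *
      ∏ j ∈ (Finset.range (M + 1)).erase k, (1 - a * q ^ k * q ^ j) =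
      qShiftedFactorial (a * q ^ k) q (M + 1) := by
    rw [qShiftedFactorial, ← Finset.mul_prod_erase _ _ hmem, two_mul, pow_add, mul_assoc a]
  have h3 : qShiftedFactorial a q (2 * M + 1) = qShiftedFactorial a q k *
      qShiftedFactorial (a * q ^ k) q (M + 1) *
      qShiftedFactorial (a * q / (q ^ M)⁻¹ * q ^ k) q (M - k) := by
    have e : 2 * M + 1 = k + (M + 1) + (M - k) := by omega
    rw [e, qShiftedFactorial_add, qShiftedFactorial_add]
    congr 2
    field_simp
    ring
  have h4 : ∏ j ∈ (Finset.range (M + 1)).erase k, ((q ^ k)⁻¹ - (q ^ j)⁻¹) =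
      (∏ j ∈ Finset.range k, ((q ^ k)⁻¹ - (q ^ j)⁻¹)) *
      ∏ i ∈ Finset.range (M - k), ((q ^ k)⁻¹ - (q ^ (k + 1 + i))⁻¹) := by
    have : (Finset.range (M + 1)).erase k = Finset.range k ∪ Finset.Ico (k + 1) (M + 1) := by
      ext j; simp; omega
    rw [this, Finset.prod_union, Finset.prod_Ico_eq_prod_range]
    · congr 2; congr 1; omega
    · rw [Finset.disjoint_left]; intro j; simp; omega
  have h5 : q ^ (k * k) * ∏ j ∈ Finset.range k, ((q ^ k)⁻¹ - (q ^ j)⁻¹) =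
      qShiftedFactorial q q k := by
    have hpow : q ^ (k * k) = ∏ _j ∈ Finset.range k, q ^ k := by
      rw [Finset.prod_const, Finset.card_range, ← pow_mul]
    rw [qShiftedFactorial, ← Finset.prod_range_reflect (fun i => 1 - q * q ^ i), hpow,
      ← Finset.prod_mul_distrib]
    refine Finset.prod_congr rfl fun j hj => ?_
    have hj := Finset.mem_range.1 hj
    have : q ^ k = q * q ^ (k - 1 - j) * q ^ j := by
      rw [← pow_succ', ← pow_add]; congr 1; omega
    rw [mul_sub, mul_inv_cancel₀ (pow_ne_zero _ hq)]
    nth_rewrite 1 [this]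
    field_simp
  have h6 : q ^ (k * (M - k)) * ∏ i ∈ Finset.range (M - k), ((q ^ k)⁻¹ - (q ^ (k + 1 + i))⁻¹) =
      ∏ i ∈ Finset.range (M - k), (1 - (q ^ (i + 1))⁻¹) := by
    have hpow : q ^ (k * (M - k)) = ∏ _j ∈ Finset.range (M - k), q ^ k := by
      rw [Finset.prod_const, Finset.card_range, ← pow_mul]
    rw [hpow, ← Finset.prod_mul_distrib]
    refine Finset.prod_congr rfl fun j hj => ?_
    rw [add_assoc, pow_add, add_comm 1 j]
    field_simp
  have h7 : qShiftedFactorial (q ^ M)⁻¹ q k *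
      ∏ i ∈ Finset.range (M - k), (1 - (q ^ (i + 1))⁻¹) =
      ∏ i ∈ Finset.range M, (1 - (q ^ (i + 1))⁻¹) := by
    rw [← Finset.prod_range_mul_prod_Ico _ (Nat.sub_le M k), Finset.prod_Ico_eq_prod_range,
      mul_comm, qShiftedFactorial, Nat.sub_sub_self hk,
      ← Finset.prod_range_reflect (fun i => 1 - (q ^ M)⁻¹ * q ^ i)]
    congr 1
    refine Finset.prod_congr rfl fun j hj => ?_
    have hj := Finset.mem_range.1 hj
    have : q ^ M = q ^ (M - k + j + 1) * q ^ (k - 1 - j) := by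
      rw [← pow_add]; congr 1; omega
    rw [this]
    field_simp
  have h8 := qShiftedFactorial_add q q k (M - k)
  rw [Nat.add_sub_cancel' hk] at h8
  have h9 : q ^ (M * k) = q ^ (k * k) * q ^ (k * (M - k)) := by
    rw [← pow_add, ← mul_add, Nat.add_sub_cancel' hk, mul_comm]
  rw [h1, h4, h3, h8, ← h7, ← h6, ← h5, ← h2, h9, wellPoisedFactor, wellPoisedFactor,
    mul_div_cancel_left₀ _ ha]
  ring

theorem sum_wellPoised_eq_zero (hq : q ≠ 0) (ha : a ≠ 0) {m h : ℕ} (hm : m < M) (hh : h + m = M)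
    (hinj : Set.InjOn (quadraticNode a q) (Finset.range (M + 1) : Finset ℕ)) {f : ℕ → K}
    (hf : IsNodePolynomial a q M m f) :
    ∑ k ∈ Finset.range (M + 1), (1 - a * q ^ (2 * k)) * q ^ (h * k) * wellPoisedFactor a q M a k *
      wellPoisedFactor a q M (q ^ M)⁻¹ k * f k = 0 := by
  obtain ⟨P, hP, hf⟩ := hf
  have hcoeff := Lagrange.coeff_eq_sum (P := P) hinj (by
    rw [Finset.card_range]
    exact (natDegree_le_iff_degree_le.1 hP).trans_lt (by exact_mod_cast (by omega : m < M + 1)))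
  rw [Finset.card_range, Nat.add_sub_cancel, coeff_eq_zero_of_natDegree_lt (hP.trans_lt hm)]
    at hcoeff
  rw [← mul_zero (qShiftedFactorial a q (2 * M + 1) * qShiftedFactorial q q M *
        ∏ i ∈ Finset.range M, (1 - (q ^ (i + 1))⁻¹)), hcoeff, Finset.mul_sum]
  refine Finset.sum_congr rfl fun k hk => ?_
  have hkM : k ≤ M := by have := Finset.mem_range.1 hk; omega
  have hne : ∏ j ∈ (Finset.range (M + 1)).erase k,
      (quadraticNode a q k - quadraticNode a q j) ≠ 0 := by
    refine Finset.prod_ne_zero_iff.2 fun j hj => sub_ne_zero.2 fun he => ?_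
    have hj := Finset.mem_erase.1 hj
    exact hj.1 (hinj hj.2 hk he.symm)
  rw [← wellPoised_weight hq ha hkM, hf k hkM, mul_div_assoc', eq_div_iff hne]
  have : q ^ (M * k) = q ^ (h * k) * q ^ (m * k) := by rw [← pow_add, ← add_mul, hh]
  rw [this]
  ring

end WellPoised

/-! ### Second-order expansions in the deformation exponent -/

section Perturbation

variable {K : Type*} [Field K] {O : Subring K} {t : O}

/-- `φ c = 1 + A c t + (B c + C c²) t²` modulo `t³` over `O`, uniformly in the integer `c`. -/
def HasQuadraticExpansion (t : O) (φ : ℤ → K) : Prop :=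
  ∃ A B C : O, ∀ c : ℤ, ∃ r : O, φ c = 1 + A * c * t + (B * c + C * c ^ 2) * t ^ 2 + r * t ^ 3

theorem HasQuadraticExpansion.one : HasQuadraticExpansion t (fun _ => (1 : K)) :=
  ⟨0, 0, 0, fun _ => ⟨0, by simp⟩⟩

/-- The cross term `(A c)(A' c)` only feeds the `c^2` coefficient, so the shape is stable under
products. -/
theorem HasQuadraticExpansion.mul {φ ψ : ℤ → K} (hφ : HasQuadraticExpansion t φ)
    (hψ : HasQuadraticExpansion t ψ) : HasQuadraticExpansion t (fun c => φ c * ψ c) := by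
  obtain ⟨A, B, C, h⟩ := hφ
  obtain ⟨A', B', C', h'⟩ := hψ
  refine ⟨A + A', B + B', C + C' + A * A', fun c => ?_⟩
  obtain ⟨r, hr⟩ := h c
  obtain ⟨r', hr'⟩ := h' c
  refine ⟨r * (1 + A' * c * t + (B' * c + C' * c ^ 2) * t ^ 2 + r' * t ^ 3) +
    r' * (1 + A * c * t + (B * c + C * c ^ 2) * t ^ 2) + A * c * (B' * c + C' * c ^ 2) +
    A' * c * (B * c + C * c ^ 2) + (B * c + C * c ^ 2) * (B' * c + C' * c ^ 2) * t, ?_⟩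
  beta_reduce
  rw [hr, hr']
  push_cast
  ring

theorem HasQuadraticExpansion.prod {ι : Type*} (s : Finset ι) {φ : ι → ℤ → K}
    (h : ∀ i ∈ s, HasQuadraticExpansion t (φ i)) :
    HasQuadraticExpansion t (fun c => ∏ i ∈ s, φ i c) := by
  classical
  induction s using Finset.induction_on with
  | empty => simpa using HasQuadraticExpansion.one
  | insert i s hi ih =>
    simp only [Finset.prod_insert hi]
    exact (h i (by simp)).mul (ih fun j hj => h j (by simp [hj]))

theorem HasQuadraticExpansion.comp_neg {φ : ℤ → K} (h : HasQuadraticExpansion t φ) :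
    HasQuadraticExpansion t (fun c => φ (-c)) := by
  obtain ⟨A, B, C, h⟩ := h
  refine ⟨-A, -B, C, fun c => ?_⟩
  obtain ⟨r, hr⟩ := h (-c)
  refine ⟨r, ?_⟩
  beta_reduce
  rw [hr]
  push_cast
  ring

theorem hasQuadraticExpansion_zpow {half : O} (hh : (2 : K) * half = 1) {x : K} (hx : x = 1 + t)
    (hx0 : x ≠ 0) (hxi : x⁻¹ ∈ O) : HasQuadraticExpansion t (fun c => x ^ c) := by
  -- The binomial coefficient `c(c-1)/2`.
  refine ⟨1, -half, half, fun c => ?_⟩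
  induction c using Int.induction_on with
  | zero => exact ⟨0, by simp⟩
  | succ i ih =>
    obtain ⟨r, hr⟩ := ih
    refine ⟨r * (1 + t) + half * i ^ 2 - half * i, ?_⟩
    beta_reduce at hr ⊢
    rw [zpow_add_one₀ hx0, hr, hx]
    push_cast
    linear_combination (-(i : K) * t ^ 2) * hh
  | pred i ih =>
    obtain ⟨r, hr⟩ := ih
    let y : O := ⟨x⁻¹, hxi⟩
    refine ⟨y * (r - half * (i + 1) ^ 2 - half * (i + 1)), ?_⟩
    have hy : (y : K) = x⁻¹ := rfl
    beta_reduce at hr ⊢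
    rw [zpow_sub_one₀ hx0, hr]
    push_cast
    rw [hy]
    field_simp
    rw [hx]
    linear_combination (-(i + 1 : K) * t ^ 2) * hh

theorem hasQuadraticExpansion_one_sub_mul_div {φ : ℤ → K} (h : HasQuadraticExpansion t φ) {v : K}
    (hv : v ∈ O) (hv1 : 1 - v ≠ 0) (hvi : (1 - v)⁻¹ ∈ O) :
    HasQuadraticExpansion t (fun c => (1 - v * φ c) / (1 - v)) := by
  obtain ⟨A, B, C, h⟩ := h
  -- `(1 - vφ)/(1 - v) = 1 + w(φ - 1)` with `w = -v/(1 - v)`.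
  let w : O := -(⟨v, hv⟩ * ⟨_, hvi⟩)
  have hw : (w : K) = -(v * (1 - v)⁻¹) := rfl
  refine ⟨w * A, w * B, w * C, fun c => ?_⟩
  obtain ⟨r, hr⟩ := h c
  refine ⟨w * r, ?_⟩
  beta_reduce
  rw [hr]
  push_cast
  rw [hw]
  field_simp
  ring

/-- The expansion of a product of values `φ c` with `∑ c = σ` and `∑ c² = π`. -/
theorem HasQuadraticExpansion.exists_powerSum {half : O} (hh : (2 : K) * half = 1) {φ : ℤ → K}
    (h : HasQuadraticExpansion t φ) :
    ∃ D : O, ∀ (c e a b : ℤ) (k : ℕ), c + e + k * (a + b) = 0 → ∃ r : O,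
      φ c * φ e * (φ a * φ b) ^ k =
        1 + D * ((c ^ 2 + e ^ 2 + k * (a ^ 2 + b ^ 2) : ℤ) : K) * t ^ 2 + r * t ^ 3 := by
  obtain ⟨A, B, C, h⟩ := h
  -- The cross terms `A² ∑_{i<j} c_i c_j` equal `A²(σ² - π)/2`, so the expansion depends on `σ` and
  -- `π` alone, and only `π` survives at `σ = 0`.
  let T : ℤ → ℤ → K → Prop := fun σ π z => ∃ r : O,
    z = 1 + A * σ * t + (B * σ + half * A ^ 2 * σ ^ 2 + (C - half * A ^ 2) * π) * t ^ 2 + r * t ^ 3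
  have hT : ∀ c, T c (c ^ 2) (φ c) := by
    intro c
    obtain ⟨r, hr⟩ := h c
    refine ⟨r, ?_⟩
    rw [hr]
    push_cast
    ring
  have hmul : ∀ {σ π z σ' π' z'}, T σ π z → T σ' π' z' → T (σ + σ') (π + π') (z * z') := by
    rintro σ π z σ' π' z' ⟨r, rfl⟩ ⟨r', rfl⟩
    let u : O := B * σ + half * A ^ 2 * σ ^ 2 + (C - half * A ^ 2) * π
    let u' : O := B * σ' + half * A ^ 2 * σ' ^ 2 + (C - half * A ^ 2) * π'
    refine ⟨r * (1 + A * σ' * t + u' * t ^ 2 + r' * t ^ 3) + r' * (1 + A * σ * t + u * t ^ 2) +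
      A * σ * u' + A * σ' * u + u * u' * t, ?_⟩
    simp only [u, u']
    push_cast
    linear_combination (-(A : K) ^ 2 * σ * σ' * t ^ 2) * hh
  have hpow : ∀ {σ π z} (k : ℕ), T σ π z → T (k * σ) (k * π) (z ^ k) := by
    intro σ π z k hz
    induction k with
    | zero => exact ⟨0, by simp⟩
    | succ k ih =>
      have := hmul ih hz
      rw [pow_succ]
      convert this using 1 <;> push_cast <;> ring
  refine ⟨C - half * A ^ 2, fun c e a b k hs => ?_⟩
  obtain ⟨r, hr⟩ := hmul (hmul (hT c) (hT e)) (hpow k (hmul (hT a) (hT b)))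
  rw [hs] at hr
  refine ⟨r, ?_⟩
  rw [hr]
  push_cast
  ring

end Perturbation

/-! ### Eliminating the quadratic term -/

section Perturbation

variable {K : Type*} [Field K] {O : Subring K} {t : O}

theorem exists_sum_eq_mul {ι : Type*} (s : Finset ι) {f : ι → K} {u : K}
    (h : ∀ i ∈ s, ∃ r : O, f i = u * r) : ∃ r : O, ∑ i ∈ s, f i = u * r := by
  classical
  induction s using Finset.induction_on with
  | empty => exact ⟨0, by simp⟩
  | insert i s hi ih =>
    obtain ⟨r, hr⟩ := h i (by simp)
    obtain ⟨r', hr'⟩ := ih fun j hj => h j (by simp [hj])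
    exact ⟨r + r', by rw [Finset.sum_insert hi, hr, hr']; push_cast; ring⟩

theorem qShiftedFactorial_mem {a q : K} (ha : a ∈ O) (hq : q ∈ O) (k : ℕ) :
    qShiftedFactorial a q k ∈ O :=
  O.prod_mem fun i _ => O.sub_mem O.one_mem (O.mul_mem ha (O.pow_mem hq i))

theorem qShiftedFactorial_inv_mem {a q : K} {k : ℕ} (h : ∀ j < k, (1 - a * q ^ j)⁻¹ ∈ O) :
    (qShiftedFactorial a q k)⁻¹ ∈ O := by
  rw [qShiftedFactorial, ← Finset.prod_inv_distrib]
  exact O.prod_mem fun i hi => h i (Finset.mem_range.1 hi)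

variable {a q x : K} {M : ℕ}

theorem wellPoisedFactor_self (ha : a ≠ 0) (k : ℕ) : wellPoisedFactor a q M a k =
    qShiftedFactorial a q k * qShiftedFactorial (q * q ^ k) q (M - k) := by
  rw [wellPoisedFactor, mul_div_cancel_left₀ _ ha]

theorem hasQuadraticExpansion_wellPoisedFactor {half : O} (hh : (2 : K) * half = 1)
    (hx : x = 1 + t) (hx0 : x ≠ 0) (hxi : x⁻¹ ∈ O) (ha : a ≠ 0) (haO : a ∈ O) (hqO : q ∈ O)
    (h0 : ∀ j < M, 1 - a * q ^ j ≠ 0 ∧ (1 - a * q ^ j)⁻¹ ∈ O)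
    (h1 : ∀ j < M, 1 - q * q ^ j ≠ 0 ∧ (1 - q * q ^ j)⁻¹ ∈ O) {k : ℕ} (hk : k ≤ M) :
    HasQuadraticExpansion t
      (fun c => wellPoisedFactor a q M (a * x ^ c) k / wellPoisedFactor a q M a k) := by
  have hz := hasQuadraticExpansion_zpow hh hx hx0 hxi
  have e : (fun c => wellPoisedFactor a q M (a * x ^ c) k / wellPoisedFactor a q M a k) =
      fun c : ℤ => (∏ j ∈ Finset.range k, (1 - a * q ^ j * x ^ c) / (1 - a * q ^ j)) *
        ∏ j ∈ Finset.range (M - k), (1 - q * q ^ (k + j) * x ^ (-c)) / (1 - q * q ^ (k + j)) := by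
    funext c
    rw [wellPoisedFactor_self ha, wellPoisedFactor, Finset.prod_div_distrib,
      Finset.prod_div_distrib, div_mul_div_comm]
    simp only [qShiftedFactorial]
    congr 2 <;> refine Finset.prod_congr rfl fun j _ => ?_
    · ring
    · rw [zpow_neg]
      field_simp
      ring
    · ring
  rw [e]
  refine (HasQuadraticExpansion.prod _ fun j hj => ?_).mul
    (HasQuadraticExpansion.prod _ fun j hj => ?_)
  · have := h0 j (by have := Finset.mem_range.1 hj; omega)
    exact hasQuadraticExpansion_one_sub_mul_div hz (O.mul_mem haO (O.pow_mem hqO j)) this.1 this.2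
  · have := h1 (k + j) (by have := Finset.mem_range.1 hj; omega)
    exact (hasQuadraticExpansion_one_sub_mul_div hz
      (O.mul_mem hqO (O.pow_mem hqO _)) this.1 this.2).comp_neg

/-- Two vanishing deformations of a well-poised sum, with parameters `a x^c` whose exponents add up
to `0` but with different sums of squares, force the sum itself to vanish modulo `(x - 1)^3`. -/
theorem exists_sum_eq_cube_mul {half : O} (hh : (2 : K) * half = 1)
    (hx : x = 1 + t) (hx0 : x ≠ 0) (hxi : x⁻¹ ∈ O) (ha : a ≠ 0) (haO : a ∈ O) (hqO : q ∈ O)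
    (h0 : ∀ j < M, 1 - a * q ^ j ≠ 0 ∧ (1 - a * q ^ j)⁻¹ ∈ O)
    (h1 : ∀ j < M, 1 - q * q ^ j ≠ 0 ∧ (1 - q * q ^ j)⁻¹ ∈ O)
    (h : ℕ) {c e α β α' β' : ℤ} (hs : c + e + h * (α + β) = 0) (hs' : c + e + h * (α' + β') = 0)
    (hne : ((h * (α' ^ 2 + β' ^ 2) - h * (α ^ 2 + β ^ 2) : ℤ) : K) ≠ 0)
    (hinv : ((h * (α' ^ 2 + β' ^ 2) - h * (α ^ 2 + β ^ 2) : ℤ) : K)⁻¹ ∈ O)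
    (hz : ∀ p : ℤ × ℤ, p = (α, β) ∨ p = (α', β') →
      ∑ k ∈ Finset.range (M + 1), (1 - a * q ^ (2 * k)) * q ^ (h * k) *
        wellPoisedFactor a q M a k * wellPoisedFactor a q M (a * x ^ c) k *
        (wellPoisedFactor a q M (a * x ^ e) k * (wellPoisedFactor a q M (a * x ^ p.1) k *
          wellPoisedFactor a q M (a * x ^ p.2) k) ^ h) = 0) :
    ∃ r : O, ∑ k ∈ Finset.range (M + 1), (1 - a * q ^ (2 * k)) * q ^ (h * k) *
      wellPoisedFactor a q M a k ^ (2 * h + 3) = (t : K) ^ 3 * r := by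
  set T : ℕ → K := fun k => (1 - a * q ^ (2 * k)) * q ^ (h * k) *
      wellPoisedFactor a q M a k ^ (2 * h + 3) with hT
  have hTO : ∀ k, T k ∈ O := fun k => by
    simp only [hT, wellPoisedFactor_self ha]
    exact O.mul_mem (O.mul_mem (O.sub_mem O.one_mem (O.mul_mem haO (O.pow_mem hqO _)))
      (O.pow_mem hqO _)) (O.pow_mem (O.mul_mem (qShiftedFactorial_mem haO hqO _)
      (qShiftedFactorial_mem (O.mul_mem hqO (O.pow_mem hqO _)) hqO _)) _)
  have hw : ∀ k ≤ M, wellPoisedFactor a q M a k ≠ 0 := fun k hk => by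
    rw [wellPoisedFactor_self ha]
    refine mul_ne_zero (Finset.prod_ne_zero_iff.2 fun j hj => (h0 j ?_).1)
      (Finset.prod_ne_zero_iff.2 fun j hj => ?_)
    · have := Finset.mem_range.1 hj; omega
    · rw [mul_assoc, ← pow_add]
      exact (h1 (k + j) (by have := Finset.mem_range.1 hj; omega)).1
  have hD : ∀ k ≤ M, ∃ D : O, ∀ p : ℤ × ℤ, c + e + h * (p.1 + p.2) = 0 → ∃ r : O,
      (1 - a * q ^ (2 * k)) * q ^ (h * k) *
        wellPoisedFactor a q M a k * wellPoisedFactor a q M (a * x ^ c) k *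
        (wellPoisedFactor a q M (a * x ^ e) k * (wellPoisedFactor a q M (a * x ^ p.1) k *
          wellPoisedFactor a q M (a * x ^ p.2) k) ^ h) =
        T k * (1 + D * ((c ^ 2 + e ^ 2 + h * (p.1 ^ 2 + p.2 ^ 2) : ℤ) : K) * t ^ 2 + r * t ^ 3) := by
    intro k hk
    obtain ⟨D, hD⟩ := (hasQuadraticExpansion_wellPoisedFactor hh hx hx0 hxi ha haO hqO h0 h1
      hk).exists_powerSum hh
    refine ⟨D, fun p hp => ?_⟩
    obtain ⟨r, hr⟩ := hD c e p.1 p.2 h hp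
    refine ⟨r, ?_⟩
    rw [← hr, hT]
    have := hw k hk
    beta_reduce
    rw [div_mul_div_comm, div_mul_div_comm, div_pow, mul_pow _ _ h, div_mul_div_comm,
      mul_div_assoc', eq_div_iff (by positivity)]
    ring
  choose! D hD using hD
  have hsum : ∀ p : ℤ × ℤ, p = (α, β) ∨ p = (α', β') → ∃ r : O,
      ∑ k ∈ Finset.range (M + 1), T k + ((c ^ 2 + e ^ 2 + h * (p.1 ^ 2 + p.2 ^ 2) : ℤ) : K) * t ^ 2 *
        ∑ k ∈ Finset.range (M + 1), T k * D k = (t : K) ^ 3 * r := by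
    intro p hp
    have hp0 : c + e + h * (p.1 + p.2) = 0 := by rcases hp with rfl | rfl <;> assumption
    rw [Finset.mul_sum, ← Finset.sum_add_distrib, ← sub_zero (Finset.sum _ _), ← hz p hp,
      ← Finset.sum_sub_distrib]
    refine exists_sum_eq_mul _ fun k hk => ?_
    obtain ⟨r, hr⟩ := hD k (by have := Finset.mem_range.1 hk; omega) p hp0
    refine ⟨-⟨T k, hTO k⟩ * r, ?_⟩
    rw [hr]
    push_cast
    ring
  obtain ⟨r, hr⟩ := hsum _ (Or.inl rfl)
  obtain ⟨r', hr'⟩ := hsum _ (Or.inr rfl)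
  -- From `T + π S ≡ 0` and `T + π' S ≡ 0`, the combination `π'` times the first minus `π` times the
  -- second leaves `(π' - π) T`.
  refine ⟨⟨_, hinv⟩ * (((c ^ 2 + e ^ 2 + h * (α' ^ 2 + β' ^ 2) : ℤ) : O) * r -
    ((c ^ 2 + e ^ 2 + h * (α ^ 2 + β ^ 2) : ℤ) : O) * r'), ?_⟩
  rw [Subring.coe_mul, mul_left_comm, eq_inv_mul_iff_mul_eq₀ hne]
  push_cast at hr hr' ⊢
  linear_combination ((c ^ 2 + e ^ 2 + h * (α' ^ 2 + β' ^ 2) : K)) * hr -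
    ((c ^ 2 + e ^ 2 + h * (α ^ 2 + β ^ 2) : K)) * hr'

end Perturbation

/-! ### Vanishing of the deformed sums -/

section Vanishing

variable {K : Type*} [Field K] {q : K}

theorem zpow_ne_one_of_pow_ne_one (hq1 : ∀ j : ℕ, 0 < j → q ^ j ≠ 1) {j : ℤ} (hj : j ≠ 0) :
    q ^ j ≠ 1 := by
  obtain ⟨m, rfl | rfl⟩ := j.eq_nat_or_neg
  · rw [zpow_natCast]
    exact hq1 m (by omega)
  · rw [zpow_neg, zpow_natCast, ne_eq, inv_eq_one]
    exact hq1 m (by omega)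

theorem mul_pow_zpow_eq (hq : q ≠ 0) (n : ℕ) (c : ℤ) : q * (q ^ n) ^ c = q ^ (1 + n * c) := by
  rw [zpow_add₀ hq, zpow_one, zpow_mul, zpow_natCast]

theorem quadraticNode_injective (hq : q ≠ 0) (hq1 : ∀ j : ℕ, 0 < j → q ^ j ≠ 1) {d : ℕ}
    (hd : 0 < d) : Function.Injective (quadraticNode q (q ^ d)) := by
  intro k j hkj
  by_contra hne
  have h1 : ((q ^ d) ^ j - (q ^ d) ^ k) * (1 - q * (q ^ d) ^ k * (q ^ d) ^ j) = 0 := by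
    simp only [quadraticNode] at hkj
    field_simp at hkj
    linear_combination hkj
  rcases mul_eq_zero.1 h1 with h | h
  · refine zpow_ne_one_of_pow_ne_one hq1 (j := d * j - d * k) ?_ ?_
    · rw [← mul_sub]
      exact mul_ne_zero (by omega) (by omega)
    · rw [zpow_sub₀ hq, div_eq_one_iff_eq (zpow_ne_zero _ hq)]
      rw [← pow_mul, ← pow_mul] at h
      exact_mod_cast sub_eq_zero.1 h
  · refine hq1 (1 + d * k + d * j) (by omega) ?_
    rw [pow_add, pow_add, pow_one, pow_mul, pow_mul]
    linear_combination -h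

/-- A zero factor would force `d + d j = n c`, hence `d ∣ c` by coprimality and `c = 0` by size,
which is absurd. -/
theorem qShiftedFactorial_div_ne_zero (hq : q ≠ 0) (hq1 : ∀ j : ℕ, 0 < j → q ^ j ≠ 1) {d n : ℕ}
    (hdn : d.Coprime n) (hd : 0 < d) {c : ℤ} (hc : |c| < d) (m : ℕ) :
    qShiftedFactorial (q * q ^ d / (q * (q ^ n) ^ c)) (q ^ d) m ≠ 0 := by
  refine Finset.prod_ne_zero_iff.2 fun j _ => sub_ne_zero.2 fun h => ?_
  refine zpow_ne_one_of_pow_ne_one hq1 (j := d + d * j - n * c) ?_ ?_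
  · intro h0
    have hdvd : (d : ℤ) ∣ n * c := ⟨1 + j, by linarith⟩
    have hc0 : c = 0 := Int.eq_zero_of_abs_lt_dvd
      ((Nat.isCoprime_iff_coprime.2 hdn).dvd_of_dvd_mul_left hdvd) hc
    subst hc0
    have : (0 : ℤ) < d + d * j := by positivity
    omega
  · rw [zpow_sub₀ hq, zpow_add₀ hq, zpow_mul, zpow_mul, zpow_natCast, zpow_natCast, zpow_natCast, h]
    have := pow_ne_zero n hq
    field_simp

theorem sum_wellPoised_pow_eq_zero (hq : q ≠ 0) (hq1 : ∀ j : ℕ, 0 < j → q ^ j ≠ 1)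
    {d n h M m₀ m₁ : ℕ} (hdn : d.Coprime n) (hd : d = 2 * h + 3) (hh : 0 < h) {s e : ℤ}
    (hM : (d : ℤ) * M = (d - s) * n - 1) (hs : s - d + e + h * s = 0)
    (hm₀ : 2 * e * n + 1 = d + d * (2 * m₀)) (hm₁ : s * n + 1 = d + d * m₁) {α β : ℤ}
    (hαβ : α + β = s) (he : |e| < d) (hα : |α| < d) (hβ : |β| < d) :
    ∑ k ∈ Finset.range (M + 1), (1 - q * (q ^ d) ^ (2 * k)) * (q ^ d) ^ (h * k) *
      wellPoisedFactor q (q ^ d) M q k * wellPoisedFactor q (q ^ d) M (q * (q ^ n) ^ (s - d)) k *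
      (wellPoisedFactor q (q ^ d) M (q * (q ^ n) ^ e) k *
        (wellPoisedFactor q (q ^ d) M (q * (q ^ n) ^ α) k *
          wellPoisedFactor q (q ^ d) M (q * (q ^ n) ^ β) k) ^ h) = 0 := by
  have hd0 : 0 < d := by omega
  have hQ : q ^ d ≠ 0 := pow_ne_zero _ hq
  have hb : ∀ c : ℤ, q * (q ^ n) ^ c ≠ 0 := fun c =>
    mul_ne_zero hq (zpow_ne_zero _ (pow_ne_zero _ hq))
  have hnv := fun {c : ℤ} (hc : |c| < d) (m : ℕ) =>
    qShiftedFactorial_div_ne_zero hq hq1 hdn hd0 hc m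
  have hpoly₀ : IsNodePolynomial q (q ^ d) M m₀
      (wellPoisedFactor q (q ^ d) M (q * (q ^ n) ^ e)) := by
    refine isNodePolynomial_wellPoisedFactor hQ hq (hb e) ?_ (hnv he _)
    rw [mul_pow_zpow_eq hq, sq, ← zpow_add₀ hq, ← pow_mul, ← pow_succ', ← zpow_natCast]
    congr 1
    push_cast
    linarith
  have hpoly₁ : IsNodePolynomial q (q ^ d) M m₁
      (fun k => wellPoisedFactor q (q ^ d) M (q * (q ^ n) ^ α) k *
        wellPoisedFactor q (q ^ d) M (q * (q ^ n) ^ β) k) := by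
    refine isNodePolynomial_wellPoisedFactor_mul hQ hq (hb α) (hb β) ?_ (hnv hα _) (hnv hβ _)
    rw [mul_pow_zpow_eq hq, mul_pow_zpow_eq hq, ← zpow_add₀ hq, ← pow_mul, ← pow_succ',
      ← zpow_natCast]
    congr 1
    push_cast
    subst hαβ
    linarith
  -- The vanishing total exponent `hs` makes the degrees add up to exactly `M - h`, as the power
  -- `Q^(hk)` requires.
  have hdeg : h + (m₀ + h * m₁) = M := by
    have hdz : (d : ℤ) = 2 * h + 3 := by exact_mod_cast hd
    have : (2 * d : ℤ) * (h + (m₀ + h * m₁)) = 2 * d * M := by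
      linear_combination (-2 : ℤ) * hM - hm₀ - 2 * (h : ℤ) * hm₁ + 2 * (n : ℤ) * hs - hdz
    have := mul_left_cancel₀ (by positivity) this
    exact_mod_cast this
  have hterm : q * (q ^ n) ^ (s - d) = ((q ^ d) ^ M)⁻¹ := by
    rw [mul_pow_zpow_eq hq, ← pow_mul, ← zpow_natCast, ← zpow_neg]
    congr 1
    push_cast
    linarith
  rw [hterm]
  exact sum_wellPoised_eq_zero hQ hq (by omega) hdeg
    (quadraticNode_injective hq hq1 hd0).injOn (hpoly₀.mul (hpoly₁.pow h))

end Vanishing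

/-! ### The truncated series modulo `(q^n - 1)^3` -/

section Congruence

variable {K : Type*} [Field K] {O : Subring K} {q : K}

theorem one_sub_mul_qInteger {R : Type*} [CommRing R] (q : R) (m : ℕ) :
    (1 - q) * qInteger q m = 1 - q ^ m :=
  mul_neg_geom_sum q m

theorem exists_sum_qInteger_eq_cube_mul [CharZero K] (hqO : q ∈ O) (hqi : q⁻¹ ∈ O) (hq : q ≠ 0)
    (hrat : ∀ m : ℤ, (m : K)⁻¹ ∈ O) (hq1 : ∀ j : ℕ, 0 < j → q ^ j ≠ 1) {d n h M m₀ m₁ : ℕ}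
    (hinv : ∀ j : ℕ, ¬ n ∣ j → (1 - q ^ j)⁻¹ ∈ O)
    (hdn : d.Coprime n) (hd : d = 2 * h + 3) (hh : 0 < h) (hn : 1 < n) {s e : ℤ}
    (hs1 : 0 < s) (hs2 : s < 3)
    (hM : (d : ℤ) * M = (d - s) * n - 1) (hs : s - d + e + h * s = 0)
    (hm₀ : 2 * e * n + 1 = d + d * (2 * m₀)) (hm₁ : s * n + 1 = d + d * m₁)
    (he : |e| < d) :
    ∃ r : O, ∑ k ∈ Finset.range n, qInteger q (2 * d * k + 1) *
      (qShiftedFactorial q (q ^ d) k ^ d / qShiftedFactorial (q ^ d) (q ^ d) k ^ d) *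
      q ^ (d * (d - 3) * k / 2) = (q ^ n - 1) ^ 3 * r := by
  have hd0 : 0 < d := by omega
  have hdz : (d : ℤ) = 2 * h + 3 := by exact_mod_cast hd
  have hMn : M < n := by
    have : (d : ℤ) * M < d * n := by nlinarith
    exact_mod_cast lt_of_mul_lt_mul_left this (by positivity)
  have hQO : q ^ d ∈ O := O.pow_mem hqO d
  -- Since `1 + d M = (d - s) n`, `n ∣ 1 + d j` would give `n ∣ M - j`, impossible for `0 < M - j <
  -- n`.
  have h0 : ∀ j < M, 1 - q * (q ^ d) ^ j ≠ 0 ∧ (1 - q * (q ^ d) ^ j)⁻¹ ∈ O := by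
    intro j hj
    have e : q * (q ^ d) ^ j = q ^ (1 + d * j) := by ring
    rw [e]
    refine ⟨sub_ne_zero.2 (hq1 _ (by omega)).symm, hinv _ fun hdvd => ?_⟩
    have h1 : (n : ℤ) ∣ d * (M - j) := by
      have h2 : (n : ℤ) ∣ 1 + d * j := by exact_mod_cast hdvd
      have h3 : (d : ℤ) * (M - j) = (d - s) * n - (1 + d * j) := by linarith
      rw [h3]
      exact (Dvd.intro_left _ rfl).sub h2
    have h4 := (Nat.isCoprime_iff_coprime.2 hdn.symm).dvd_of_dvd_mul_left h1
    have := Int.le_of_dvd (by omega) h4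
    omega
  have h1 : ∀ j < n - 1, 1 - q ^ d * (q ^ d) ^ j ≠ 0 ∧ (1 - q ^ d * (q ^ d) ^ j)⁻¹ ∈ O := by
    intro j hj
    have e : q ^ d * (q ^ d) ^ j = q ^ (d * (j + 1)) := by ring
    rw [e]
    refine ⟨sub_ne_zero.2 (hq1 _ (by positivity)).symm, hinv _ fun hdvd => ?_⟩
    have := Nat.le_of_dvd (by omega) (hdn.symm.dvd_of_dvd_mul_left hdvd)
    omega
  have hqq : 1 - q ≠ 0 := by
    have := hq1 1 one_pos
    rw [pow_one] at this
    exact sub_ne_zero.2 this.symm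
  have hqqi : (1 - q)⁻¹ ∈ O := by
    have := hinv 1 (by rw [Nat.dvd_one]; omega)
    rwa [pow_one] at this
  let t : O := ⟨q ^ n - 1, O.sub_mem (O.pow_mem hqO n) O.one_mem⟩
  have ht : (t : K) = q ^ n - 1 := rfl
  have hhalf : (2 : K)⁻¹ ∈ O := by exact_mod_cast hrat 2
  have hexp : ∀ k, q ^ (d * (d - 3) * k / 2) = (q ^ d) ^ (h * k) := by
    intro k
    rw [← pow_mul]
    congr 1
    have : d - 3 = 2 * h := by omega
    rw [this, Nat.div_eq_of_eq_mul_left two_pos]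
    ring
  have hint : ∀ k, qInteger q (2 * d * k + 1) = (1 - q)⁻¹ * (1 - q * (q ^ d) ^ (2 * k)) := by
    intro k
    rw [eq_inv_mul_iff_mul_eq₀ hqq, one_sub_mul_qInteger]
    ring
  have hden : ∀ k < n, qShiftedFactorial (q ^ d) (q ^ d) k ≠ 0 ∧
      (qShiftedFactorial (q ^ d) (q ^ d) k)⁻¹ ∈ O := fun k hk =>
    ⟨Finset.prod_ne_zero_iff.2 fun j hj => (h1 j (by have := Finset.mem_range.1 hj; omega)).1,
      qShiftedFactorial_inv_mem fun j hj => (h1 j (by omega)).2⟩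
  have hne : ∀ {α β α' β' : ℤ}, (h * (α' ^ 2 + β' ^ 2) - h * (α ^ 2 + β ^ 2) : ℤ) ≠ 0 →
      ((h * (α' ^ 2 + β' ^ 2) - h * (α ^ 2 + β ^ 2) : ℤ) : K) ≠ 0 := fun h => by exact_mod_cast h
  have hlow : ∃ r : O, ∑ k ∈ Finset.range (M + 1), (1 - q * (q ^ d) ^ (2 * k)) * (q ^ d) ^ (h * k) *
      wellPoisedFactor q (q ^ d) M q k ^ (2 * h + 3) = (t : K) ^ 3 * r := by
    -- The pairs `(1, s-1)` and `(2, s-2)` have sums of squares differing by `2(3 - s)`, nonzero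
    -- because `s < 3`.
    refine exists_sum_eq_cube_mul (x := q ^ n) (half := ⟨_, hhalf⟩) (mul_inv_cancel₀ two_ne_zero)
      (by rw [ht]; ring) (pow_ne_zero n hq) (by rw [← inv_pow]; exact O.pow_mem hqi n) hq hqO hQO
      h0 (fun j hj => h1 j (by omega)) h (c := s - d) (e := e) (α := 1) (β := s - 1) (α' := 2)
      (β' := s - 2) (by linarith) (by linarith) (hne ?_) (hrat _) ?_
    · rw [← mul_sub]
      exact mul_ne_zero (by omega) (by nlinarith)
    · rintro p (rfl | rfl)
      · exact sum_wellPoised_pow_eq_zero hq hq1 hdn hd hh hM hs hm₀ hm₁ (by ring) he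
          (by rw [abs_lt]; constructor <;> omega) (by rw [abs_lt]; constructor <;> omega)
      · exact sum_wellPoised_pow_eq_zero hq hq1 hdn hd hh hM hs hm₀ hm₁ (by ring) he
          (by rw [abs_lt]; constructor <;> omega) (by rw [abs_lt]; constructor <;> omega)
  obtain ⟨r, hr⟩ := hlow
  have hhigh : ∃ r : O, ∑ k ∈ Finset.Ico (M + 1) n, qInteger q (2 * d * k + 1) *
      (qShiftedFactorial q (q ^ d) k ^ d / qShiftedFactorial (q ^ d) (q ^ d) k ^ d) *
      q ^ (d * (d - 3) * k / 2) = (q ^ n - 1) ^ 3 * r := by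
    refine exists_sum_eq_mul _ fun k hk => ?_
    have hk := Finset.mem_Ico.1 hk
    -- For `k > M` the product contains `1 - q^(1+dM) = 1 - (q^n)^(d-s)`.
    obtain ⟨u, hu⟩ : ∃ u : O, qShiftedFactorial q (q ^ d) k = (q ^ n - 1) * u := by
      obtain ⟨w, hw⟩ : ∃ w : ℕ, 1 + d * M = n * w := by
        refine ⟨(d - s).toNat, ?_⟩
        zify
        rw [Int.toNat_of_nonneg (by omega), hM]
        ring
      obtain ⟨v, hv⟩ : ∃ v : O, 1 - q * (q ^ d) ^ M = (q ^ n - 1) * v := by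
        refine ⟨-⟨qInteger (q ^ n) w, O.sum_mem fun i _ => O.pow_mem (O.pow_mem hqO n) i⟩, ?_⟩
        have := one_sub_mul_qInteger (q ^ n) w
        rw [← pow_mul, ← hw, pow_add, pow_one, pow_mul] at this
        push_cast
        rw [← this]
        ring
      have hkM : k = M + 1 + (k - (M + 1)) := by omega
      refine ⟨⟨_, qShiftedFactorial_mem hqO hQO M⟩ * v * ⟨_, qShiftedFactorial_mem
        (O.mul_mem hqO (O.pow_mem hQO (M + 1))) hQO (k - (M + 1))⟩, ?_⟩
      nth_rewrite 1 [hkM]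
      rw [qShiftedFactorial_add, qShiftedFactorial_add q _ M 1]
      simp only [qShiftedFactorial, Finset.prod_range_one, pow_zero, mul_one, hv]
      push_cast
      ring
    refine ⟨⟨qInteger q (2 * d * k + 1), O.sum_mem fun i _ => O.pow_mem hqO i⟩ * t ^ (2 * h) *
      u ^ d * ⟨_, (hden k hk.2).2⟩ ^ d * ⟨_, O.pow_mem hqO (d * (d - 3) * k / 2)⟩, ?_⟩
    rw [hu]
    push_cast
    rw [ht, mul_pow, hd, pow_add _ (2 * h) 3, div_eq_mul_inv, inv_pow]
    ring
  obtain ⟨r', hr'⟩ := hhigh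
  -- The factor `(1 - q)⁻¹ (Q;Q)_M^(-d)` undoes the clearing of denominators in the part `k ≤ M`.
  refine ⟨⟨_, hqqi⟩ * ⟨_, (hden M hMn).2⟩ ^ d * r + r', ?_⟩
  rw [← Finset.sum_range_add_sum_Ico _ (by omega : M + 1 ≤ n), hr']
  push_cast
  rw [mul_add, mul_left_comm, ← ht, ← hr, Finset.mul_sum]
  congr 1
  refine Finset.sum_congr rfl fun k hk => ?_
  have hkM : k ≤ M := by have := Finset.mem_range.1 hk; omega
  have hsplit := qShiftedFactorial_add (q ^ d) (q ^ d) k (M - k)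
  rw [Nat.add_sub_cancel' hkM] at hsplit
  have hk0 := (hden k (by omega)).1
  have hM0 := (hden M hMn).1
  rw [hsplit] at hM0 ⊢
  have hk1 := right_ne_zero_of_mul hM0
  rw [hint, hexp, wellPoisedFactor_self hq, ← hd, inv_pow, mul_pow, mul_pow]
  field_simp

end Congruence

/-! ### Localization at the cyclotomic polynomial and choice of parameters -/

/-- The rational functions over `ℚ` that can be written with a denominator coprime to `P`. -/
def coprimeDenomSubring (P : ℚ[X]) : Subring (RatFunc ℚ) where
  carrier := {f | ∃ a b : ℚ[X], b ≠ 0 ∧ IsCoprime b P ∧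
    f = algebraMap ℚ[X] (RatFunc ℚ) a / algebraMap ℚ[X] (RatFunc ℚ) b}
  zero_mem' := ⟨0, 1, one_ne_zero, isCoprime_one_left, by simp⟩
  one_mem' := ⟨1, 1, one_ne_zero, isCoprime_one_left, by simp⟩
  add_mem' := by
    rintro _ _ ⟨a, b, hb, hbP, rfl⟩ ⟨a', b', hb', hbP', rfl⟩
    refine ⟨a * b' + b * a', b * b', mul_ne_zero hb hb', hbP.mul_left hbP', ?_⟩
    have h := RatFunc.algebraMap_ne_zero hb
    have h' := RatFunc.algebraMap_ne_zero hb'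
    rw [div_add_div _ _ h h']
    simp
  mul_mem' := by
    rintro _ _ ⟨a, b, hb, hbP, rfl⟩ ⟨a', b', hb', hbP', rfl⟩
    refine ⟨a * a', b * b', mul_ne_zero hb hb', hbP.mul_left hbP', ?_⟩
    rw [div_mul_div_comm]
    simp
  neg_mem' := by
    rintro _ ⟨a, b, hb, hbP, rfl⟩
    exact ⟨-a, b, hb, hbP, by rw [map_neg, neg_div]⟩

theorem inv_mem_coprimeDenomSubring {P b : ℚ[X]} (hb : b ≠ 0) (h : IsCoprime b P) :
    (algebraMap ℚ[X] (RatFunc ℚ) b)⁻¹ ∈ coprimeDenomSubring P :=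
  ⟨1, b, hb, h, by simp⟩

theorem mem_coprimeDenomSubring (P a : ℚ[X]) :
    algebraMap ℚ[X] (RatFunc ℚ) a ∈ coprimeDenomSubring P :=
  ⟨a, 1, one_ne_zero, isCoprime_one_left, by simp⟩

theorem isCoprime_one_sub_X_pow_cyclotomic {n j : ℕ} (h : ¬ n ∣ j) :
    IsCoprime (1 - X ^ j : ℚ[X]) (cyclotomic n ℚ) := by
  have hj : 0 < j := Nat.pos_of_ne_zero fun hj => h (hj ▸ dvd_zero n)
  have : (1 - X ^ j : ℚ[X]) = -∏ i ∈ j.divisors, cyclotomic i ℚ := by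
    rw [prod_cyclotomic_eq_X_pow_sub_one hj, neg_sub]
  rw [this]
  refine IsCoprime.neg_left (IsCoprime.prod_left fun i hi => cyclotomic.isCoprime_rat ?_)
  rintro rfl
  exact h (Nat.dvd_of_mem_divisors hi)

theorem isCoprime_X_cyclotomic {n : ℕ} (hn : 0 < n) :
    IsCoprime (X : ℚ[X]) (cyclotomic n ℚ) := by
  have h : IsCoprime (X : ℚ[X]) (X ^ n - 1) := by
    refine ⟨X ^ (n - 1), -1, ?_⟩
    rw [← pow_succ, Nat.sub_add_cancel hn]
    ring
  exact h.of_isCoprime_of_dvd_right (cyclotomic.dvd_X_pow_sub_one n ℚ)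

theorem ratFuncModEq_truncatedSeries_of_params {d n h M m₀ m₁ : ℕ}
    (hdn : d.Coprime n) (hd : d = 2 * h + 3) (hh : 0 < h) (hn : 1 < n) {s e : ℤ}
    (hs1 : 0 < s) (hs2 : s < 3)
    (hM : (d : ℤ) * M = (d - s) * n - 1) (hs : s - d + e + h * s = 0)
    (hm₀ : 2 * e * n + 1 = d + d * (2 * m₀)) (hm₁ : s * n + 1 = d + d * m₁)
    (he : |e| < d) :
    RatFuncModEq (cyclotomic n ℚ ^ 3) (truncatedSeries d n) 0 := by
  have hX : algebraMap ℚ[X] (RatFunc ℚ) X = RatFunc.X := RatFunc.algebraMap_X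
  have hpow : ∀ j : ℕ, 0 < j → (1 - X ^ j : ℚ[X]) ≠ 0 := fun j hj => by
    rw [← neg_ne_zero, neg_sub]
    exact X_pow_sub_C_ne_zero hj 1
  obtain ⟨⟨r, a, b, hb, hbP, rfl⟩, hr⟩ := exists_sum_qInteger_eq_cube_mul
    (O := coprimeDenomSubring (cyclotomic n ℚ)) (q := (RatFunc.X : RatFunc ℚ))
    (hX ▸ mem_coprimeDenomSubring _ _)
    (hX ▸ inv_mem_coprimeDenomSubring X_ne_zero (isCoprime_X_cyclotomic (by omega)))
    RatFunc.X_ne_zero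
    (fun m => by
      have : ((m : RatFunc ℚ))⁻¹ = algebraMap ℚ[X] (RatFunc ℚ) (C ((m : ℚ)⁻¹)) := by
        rw [RatFunc.algebraMap_C]
        simp
      rw [this]
      exact mem_coprimeDenomSubring _ _)
    (fun j hj h => hpow j hj (by
      apply RatFunc.algebraMap_injective ℚ
      rw [map_sub, map_pow, map_one, hX, h, sub_self, map_zero]))
    (fun j hj => by
      have := inv_mem_coprimeDenomSubring (hpow j (Nat.pos_of_ne_zero fun h => hj (h ▸ dvd_zero n)))
        (isCoprime_one_sub_X_pow_cyclotomic hj)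
      rwa [map_sub, map_pow, map_one, hX] at this)
    hdn hd hh hn hs1 hs2 hM hs hm₀ hm₁ he
  refine ⟨(X ^ n - 1) ^ 3 * a, b, hb, hbP.pow_right,
    (pow_dvd_pow_of_dvd (cyclotomic.dvd_X_pow_sub_one n ℚ) 3).mul_right _, ?_⟩
  rw [sub_zero, truncatedSeries, hr, map_mul, map_pow, map_sub, map_pow, map_one, hX,
    mul_div_assoc]

/-- Writing `s n + 1 = d w` gives `M = n - w` and `m₁ = w - 1`; zero total exponent then forces `e =
(d+1)/2` for `s = 1` and `e = 1` for `s = 2`. -/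
theorem ratFuncModEq_cyclotomic_cube {d : ℕ} (hd : 5 ≤ d) (hodd : Odd d) {n : ℕ} (hn : 0 < n)
    {s : ℤ} (hs : s = 1 ∨ s = 2) (h : s * (n : ℤ) ≡ -1 [ZMOD (d : ℤ)]) :
    RatFuncModEq (cyclotomic n ℚ ^ 3) (truncatedSeries d n) 0 := by
  obtain ⟨g, hg⟩ := hodd
  obtain ⟨h', rfl⟩ : ∃ h', g = h' + 1 := ⟨g - 1, by omega⟩
  obtain ⟨w, hw⟩ : (d : ℤ) ∣ s * n + 1 := by
    have := h.symm.dvd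
    rwa [sub_neg_eq_add] at this
  have hdz : (d : ℤ) = 2 * h' + 3 := by exact_mod_cast (by omega : d = 2 * h' + 3)
  have hw1 : 1 ≤ w := by
    by_contra! hc
    have : (d : ℤ) * w ≤ 0 := mul_nonpos_of_nonneg_of_nonpos (by omega) (by omega)
    rcases hs with rfl | rfl <;> omega
  lift w to ℕ using by omega
  have hdn : d.Coprime n := by
    rw [← Nat.isCoprime_iff_coprime]
    exact ⟨w, -s, by linarith⟩
  have hdw : (d : ℤ) ≤ d * w := le_mul_of_one_le_right (by omega) hw1
  have hn1 : 1 < n := by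
    rcases hs with rfl | rfl <;> omega
  have hwn : w ≤ n := by
    have : (d : ℤ) * w ≤ d * n := by
      rcases hs with rfl | rfl <;> nlinarith
    exact_mod_cast le_of_mul_le_mul_left this (by omega)
  have hM : (d : ℤ) * ((n - w : ℕ) : ℤ) = (d - s) * n - 1 := by
    push_cast [hwn]
    linarith
  have hm₁ : s * (n : ℤ) + 1 = d + d * ((w - 1 : ℕ) : ℤ) := by
    rw [hw]
    push_cast [(by omega : 1 ≤ w)]
    ring
  rcases hs with rfl | rfl
  -- Here `2 e n + 1 = d (n + w)`, and `d` odd makes `n + w` odd, so the half-degree `m₀` is an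
  -- integer.
  · obtain ⟨m₀, hm₀⟩ : ∃ m₀ : ℕ, n + w = 2 * m₀ + 1 := by
      have h1 : n + 1 = 2 * ((h' + 1) * w) + w := by
        have : (n : ℤ) + 1 = 2 * ((h' + 1) * w) + w := by rw [← one_mul (n : ℤ), hw, hdz]; ring
        exact_mod_cast this
      exact ⟨(n + w - 1) / 2, by omega⟩
    refine ratFuncModEq_truncatedSeries_of_params (e := h' + 2) (m₀ := m₀) hdn
      (by omega : d = 2 * h' + 3) (by omega) hn1 (by omega) (by omega) hM (by rw [hdz]; ring) ?_ hm₁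
      (by rw [abs_lt]; constructor <;> omega)
    have : (n : ℤ) + w = 2 * m₀ + 1 := by exact_mod_cast hm₀
    linear_combination hw + (d : ℤ) * this - (n : ℤ) * hdz
  · obtain ⟨m₀, hm₀⟩ : ∃ m₀ : ℕ, w = 2 * m₀ + 1 := by
      have h1 : 2 * n + 1 = 2 * ((h' + 1) * w) + w := by
        have : 2 * (n : ℤ) + 1 = 2 * ((h' + 1) * w) + w := by rw [hw, hdz]; ring
        exact_mod_cast this
      exact ⟨(w - 1) / 2, by omega⟩
    refine ratFuncModEq_truncatedSeries_of_params (e := 1) (m₀ := m₀) hdn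
      (by omega : d = 2 * h' + 3) (by omega) hn1 (by omega) (by omega) hM (by rw [hdz]; ring) ?_ hm₁
      (by rw [abs_lt]; constructor <;> omega)
    have : (w : ℤ) = 2 * m₀ + 1 := by exact_mod_cast hm₀
    linear_combination hw + (d : ℤ) * this

theorem theorem1p1 (d : ℕ) (hd : 5 ≤ d) (hodd : Odd d) (n : ℕ) (hn : 0 < n) :
    ((n : ℤ) ≡ -1 [ZMOD (d : ℤ)] →
      RatFuncModEq (cyclotomic n ℚ ^ 2) (truncatedSeries d n) 0) ∧
    (2 * (n : ℤ) ≡ -1 [ZMOD (d : ℤ)] →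
      RatFuncModEq (cyclotomic n ℚ ^ 3) (truncatedSeries d n) 0) := by
  refine ⟨fun h => ?_, fun h => ratFuncModEq_cyclotomic_cube hd hodd hn (Or.inr rfl) h⟩
  -- The case `s = 1` also yields the cube, which is weakened to the square.
  obtain ⟨a, b, hb, hbP, hdvd, he⟩ :=
    ratFuncModEq_cyclotomic_cube hd hodd hn (Or.inl rfl) ((one_mul (n : ℤ)).symm ▸ h)
  have h23 : cyclotomic n ℚ ^ 2 ∣ cyclotomic n ℚ ^ 3 := pow_dvd_pow _ (by norm_num)
  exact ⟨a, b, hb, hbP.of_isCoprime_of_dvd_right h23, h23.trans hdvd, he⟩
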